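/- **Theorem 4.7.** Throughout, all spaces are Banach spaces over a fixed scalar field $\mathbb K\in\{\mathbb R,\mathbb C\}$, $\mathcal L(E,F)$ denotes the bounded linear operators, $\mathcal F(E,F)$ those of finite rank, $\overline{\mathcal F}(E,F)$ the operator-norm closure of $\mathcal F(E,F)$, and $\operatorname{tr}$ the trace of a finite rank operator. A *Banach ideal* $(\mathcal A,\mathbf A)$ assigns to each pair $(E,F)$ of Banach spaces a linear subspace $\mathcal A(E,F)\subseteq\mathcal L(E,F)$ containing $\mathcal F(E,F)$, with a complete norm $\mathbf A$ on it, such that $\mathbf A(\mathrm{id}_{\mathbb K})=1$, and $STR\in\mathcal A$ with $\mathbf A(STR)\le\|S\|\,\mathbf A(T)\,\|R\|$ whenever $T\in\mathcal A$ and $R,S$ are bounded operators for which $STR$ is defined. For pairs $(\mathcal A,\mathbf A)$, $(\mathcal B,\mathbf B)$ of this kind: * $\mathcal A\overset{1}{=}\mathcal B$ (isometrically) means that $\mathcal A(E,F)=\mathcal B(E,F)$ with equal norms for all $E,F$. * $T\in\mathcal L(E,F)$ belongs to $\mathcal A\circ\mathcal B^{-1}$ if $TS\in\mathcal A(G,F)$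 for all $G$ and all $S\in\mathcal B(G,E)$, with norm $\sup\{\mathbf A(TS):\mathbf B(S)=1\}$; and to $\mathcal B^{-1}\circ\mathcal A$ if $ST\in\mathcal A(E,G)$ for all $G$ and all $S\in\mathcal B(F,G)$, with norm $\sup\{\mathbf A(ST):\mathbf B(S)=1\}$ (with $\sup\emptyset=0$). $\mathcal A$ is *maximal* if $\mathcal A\overset{1}{=}\overline{\mathcal F}^{-1}\circ(\mathcal A\circ\overline{\mathcal F}^{-1})$, where $\overline{\mathcal F}$ carries the operator norm. * The *adjoint* $(\mathcal A^*,\mathbf A^*)$: $T\in\mathcal A^*(E,F)$ if there is $c\ge0$ such that $|\operatorname{tr}(TPSQ)|\le c\,\|P\|\,\mathbf A(S)\,\|Q\|$ for all Banach spaces $E_0,F_0$ and all $P\in\mathcal F(E_0,E)$, $S\in\mathcal A(F_0,E_0)$, $Q\in\mathcal F(F,F_0)$; $\mathbf A^*(T)$ is the infimum of such $c$. * The *conjugate* $(\mathcal A^\Delta,\mathbf A^\Delta)$: $T\in\mathcal A^\Delta(E,F)$ if there is $c\ge0$ such that $|\operatorname{tr}(TL)|\le c\,\mathbf A(L)$ for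 all $L\in\mathcal F(F,E)$; $\mathbf A^\Delta(T)$ is the infimum of such $c$. * $\mathcal A$ is *right-accessible* if for every finite-dimensional $M$, every Banach space $F$, every $T\in\mathcal L(M,F)$ and $\varepsilon>0$ there are a finite-dimensional subspace $N\subseteq F$, with inclusion $J_N^F:N\to F$, and $S\in\mathcal A(M,N)$ with $T=J_N^FS$ and $\mathbf A(S)\le(1+\varepsilon)\mathbf A(T)$. * $\mathcal A$ is *left-accessible* if for every Banach space $E$, every finite-dimensional $N$, every $T\in\mathcal L(E,N)$ and $\varepsilon>0$ there are a closed subspace $K\subseteq E$ of finite codimension, with quotient map $Q_K^E:E\to E/K$, and $S\in\mathcal A(E/K,N)$ with $T=SQ_K^E$ and $\mathbf A(S)\le(1+\varepsilon)\mathbf A(T)$. $\mathcal A$ is *accessible* if it is both right- and left-accessible. * The *$\mathcal A$-extension property* holds if for every $\varepsilon>0$, every linear isometric embedding $J:E\to G$ and every $T\in\mathcal A(E,F)$ there is $\widetilde T\in\mathcal A(G,F)$ with $T=\widetilde TJ$ and $\mathbf A(\widetilde T)\le(1+\varepsilon)\mathbf A(T)$. Let $(\mathcal A,\mathbf A)$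 be a maximal and left-accessible Banach ideal such that the $\mathcal A^*$-extension property holds. Then $\mathcal A$ is accessible, and $$\mathcal A^{\Delta\Delta}\overset{1}{=}\mathcal A^{*\Delta},$$ that is, $(\mathcal A^\Delta)^\Delta$ and $(\mathcal A^*)^\Delta$ contain the same operators, with equal norms. -/

import Mathlib

universe u

noncomputable section

/-- A continuous linear operator with finite-dimensional range (an element of `𝓕(E, F)`). -/
def IsFiniteOp {𝕜 : Type u} [RCLike 𝕜] {E F : Type u}
    [NormedAddCommGroup E] [NormedSpace 𝕜 E] [NormedAddCommGroup F] [NormedSpace 𝕜 F]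
    (T : E →L[𝕜] F) : Prop :=
  FiniteDimensional 𝕜 (LinearMap.range (T : E →ₗ[𝕜] F))

/-- The trace of an operator of finite rank on a (possibly infinite-dimensional) space: the
trace of the endomorphism that it induces on its own finite-dimensional range. For
`T x = ∑ i, aᵢ(x) • yᵢ` it is `∑ i, aᵢ(yᵢ)`. -/
def finTrace {𝕜 : Type u} [RCLike 𝕜] {E : Type u}
    [NormedAddCommGroup E] [NormedSpace 𝕜 E] (T : E →L[𝕜] E) : 𝕜 :=
  LinearMap.trace 𝕜 (LinearMap.range (T : E →ₗ[𝕜] E))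
    ((T : E →ₗ[𝕜] E).rangeRestrict.comp (LinearMap.range (T : E →ₗ[𝕜] E)).subtype)

/-- A class of operators between Banach spaces (`mem T` means that `T` belongs to the class)
together with a number `nrm T`, which is meaningful only for `T` in the class. The laws of a
Banach ideal are added in `BanachIdeal`. -/
structure OpClass (𝕜 : Type u) [RCLike 𝕜] where
  mem : ∀ {E F : Type u} [NormedAddCommGroup E] [NormedSpace 𝕜 E] [CompleteSpace E]
    [NormedAddCommGroup F] [NormedSpace 𝕜 F] [CompleteSpace F], (E →L[𝕜] F) → Prop
  nrm : ∀ {E F : Type u} [NormedAddCommGroup E] [NormedSpace 𝕜 E] [CompleteSpace E]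
    [NormedAddCommGroup F] [NormedSpace 𝕜 F] [CompleteSpace F], (E →L[𝕜] F) → ℝ

/-- A Banach ideal `(𝒜, 𝐀)` of operators between Banach spaces over `𝕜`. -/
structure BanachIdeal (𝕜 : Type u) [RCLike 𝕜] extends OpClass 𝕜 where
  mem_of_isFiniteOp : ∀ {E F : Type u}
    [NormedAddCommGroup E] [NormedSpace 𝕜 E] [CompleteSpace E]
    [NormedAddCommGroup F] [NormedSpace 𝕜 F] [CompleteSpace F] (T : E →L[𝕜] F),
    IsFiniteOp T → mem T
  mem_add : ∀ {E F : Type u}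
    [NormedAddCommGroup E] [NormedSpace 𝕜 E] [CompleteSpace E]
    [NormedAddCommGroup F] [NormedSpace 𝕜 F] [CompleteSpace F] (S T : E →L[𝕜] F),
    mem S → mem T → mem (S + T)
  mem_smul : ∀ {E F : Type u}
    [NormedAddCommGroup E] [NormedSpace 𝕜 E] [CompleteSpace E]
    [NormedAddCommGroup F] [NormedSpace 𝕜 F] [CompleteSpace F] (c : 𝕜) (T : E →L[𝕜] F),
    mem T → mem (c • T)
  mem_comp : ∀ {D E F G : Type u}
    [NormedAddCommGroup D] [NormedSpace 𝕜 D] [CompleteSpace D]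
    [NormedAddCommGroup E] [NormedSpace 𝕜 E] [CompleteSpace E]
    [NormedAddCommGroup F] [NormedSpace 𝕜 F] [CompleteSpace F]
    [NormedAddCommGroup G] [NormedSpace 𝕜 G] [CompleteSpace G]
    (S : F →L[𝕜] G) (T : E →L[𝕜] F) (R : D →L[𝕜] E), mem T → mem (S.comp (T.comp R))
  /-- `𝐀` is a norm on each component `𝒜(E, F)`. -/
  nrm_add_le : ∀ {E F : Type u}
    [NormedAddCommGroup E] [NormedSpace 𝕜 E] [CompleteSpace E]
    [NormedAddCommGroup F] [NormedSpace 𝕜 F] [CompleteSpace F] (S T : E →L[𝕜] F),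
    mem S → mem T → nrm (S + T) ≤ nrm S + nrm T
  nrm_smul : ∀ {E F : Type u}
    [NormedAddCommGroup E] [NormedSpace 𝕜 E] [CompleteSpace E]
    [NormedAddCommGroup F] [NormedSpace 𝕜 F] [CompleteSpace F] (c : 𝕜) (T : E →L[𝕜] F),
    mem T → nrm (c • T) = ‖c‖ * nrm T
  eq_zero_of_nrm_eq_zero : ∀ {E F : Type u}
    [NormedAddCommGroup E] [NormedSpace 𝕜 E] [CompleteSpace E]
    [NormedAddCommGroup F] [NormedSpace 𝕜 F] [CompleteSpace F] (T : E →L[𝕜] F),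
    mem T → nrm T = 0 → T = 0
  /-- Each component `𝒜(E, F)` is complete for `𝐀`. -/
  complete : ∀ {E F : Type u}
    [NormedAddCommGroup E] [NormedSpace 𝕜 E] [CompleteSpace E]
    [NormedAddCommGroup F] [NormedSpace 𝕜 F] [CompleteSpace F] (s : ℕ → E →L[𝕜] F),
    (∀ n, mem (s n)) →
    (∀ ε : ℝ, 0 < ε → ∃ N : ℕ, ∀ m n : ℕ, N ≤ m → N ≤ n → nrm (s m - s n) < ε) →
    ∃ T : E →L[𝕜] F, mem T ∧
      ∀ ε : ℝ, 0 < ε → ∃ N : ℕ, ∀ n : ℕ, N ≤ n → nrm (s n - T) < ε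
  nrm_comp_le : ∀ {D E F G : Type u}
    [NormedAddCommGroup D] [NormedSpace 𝕜 D] [CompleteSpace D]
    [NormedAddCommGroup E] [NormedSpace 𝕜 E] [CompleteSpace E]
    [NormedAddCommGroup F] [NormedSpace 𝕜 F] [CompleteSpace F]
    [NormedAddCommGroup G] [NormedSpace 𝕜 G] [CompleteSpace G]
    (S : F →L[𝕜] G) (T : E →L[𝕜] F) (R : D →L[𝕜] E), mem T →
    nrm (S.comp (T.comp R)) ≤ ‖S‖ * nrm T * ‖R‖
  nrm_id : nrm (ContinuousLinearMap.id 𝕜 𝕜) = 1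

namespace OpClass

variable {𝕜 : Type u} [RCLike 𝕜]

/-- Isometric identity: the same operators belong to both classes, with the same norms. -/
def IsometricEq (A B : OpClass 𝕜) : Prop :=
  ∀ (E F : Type u) [NormedAddCommGroup E] [NormedSpace 𝕜 E] [CompleteSpace E]
    [NormedAddCommGroup F] [NormedSpace 𝕜 F] [CompleteSpace F] (T : E →L[𝕜] F),
    (A.mem T ↔ B.mem T) ∧ (A.mem T → A.nrm T = B.nrm T)

/-- The approximable operators, i.e. the operator-norm limits of finite operators, with the
operator norm. -/
def approximable (𝕜 : Type u) [RCLike 𝕜] : OpClass 𝕜 where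
  mem {E F} _ _ _ _ _ _ T := T ∈ closure {S : E →L[𝕜] F | IsFiniteOp S}
  nrm T := ‖T‖

/-- The right-`ℬ`-quotient `𝒜 ∘ ℬ⁻¹`. -/
def rightQuotient (A B : OpClass 𝕜) : OpClass 𝕜 where
  mem {E _} _ _ _ _ _ _ T :=
    ∀ (G : Type u) [NormedAddCommGroup G] [NormedSpace 𝕜 G] [CompleteSpace G]
      (S : G →L[𝕜] E), B.mem S → A.mem (T.comp S)
  nrm {E _} _ _ _ _ _ _ T :=
    sSup {r : ℝ | ∃ (G : Type u) (_ : NormedAddCommGroup G) (_ : NormedSpace 𝕜 G)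
      (_ : CompleteSpace G) (S : G →L[𝕜] E),
      B.mem S ∧ B.nrm S = 1 ∧ r = A.nrm (T.comp S)}

/-- The left-`ℬ`-quotient `ℬ⁻¹ ∘ 𝒜`. -/
def leftQuotient (B A : OpClass 𝕜) : OpClass 𝕜 where
  mem {_ F} _ _ _ _ _ _ T :=
    ∀ (G : Type u) [NormedAddCommGroup G] [NormedSpace 𝕜 G] [CompleteSpace G]
      (S : F →L[𝕜] G), B.mem S → A.mem (S.comp T)
  nrm {_ F} _ _ _ _ _ _ T :=
    sSup {r : ℝ | ∃ (G : Type u) (_ : NormedAddCommGroup G) (_ : NormedSpace 𝕜 G)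
      (_ : CompleteSpace G) (S : F →L[𝕜] G),
      B.mem S ∧ B.nrm S = 1 ∧ r = A.nrm (S.comp T)}

/-- The maximal hull: the left- and right-quotient by the approximable operators. -/
def maxHull (A : OpClass 𝕜) : OpClass 𝕜 :=
  leftQuotient (approximable 𝕜) (rightQuotient A (approximable 𝕜))

/-- `𝒜` is maximal if it agrees isometrically with its maximal hull. -/
def IsMaximal (A : OpClass 𝕜) : Prop := A.IsometricEq A.maxHull

/-- `c` is an admissible constant in the definition of the adjoint `𝒜*`. -/
def AdjointBound (A : OpClass 𝕜) {E F : Type u}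
    [NormedAddCommGroup E] [NormedSpace 𝕜 E] [CompleteSpace E]
    [NormedAddCommGroup F] [NormedSpace 𝕜 F] [CompleteSpace F]
    (T : E →L[𝕜] F) (c : ℝ) : Prop :=
  0 ≤ c ∧ ∀ (E₀ F₀ : Type u)
    [NormedAddCommGroup E₀] [NormedSpace 𝕜 E₀] [CompleteSpace E₀]
    [NormedAddCommGroup F₀] [NormedSpace 𝕜 F₀] [CompleteSpace F₀]
    (P : E₀ →L[𝕜] E) (S : F₀ →L[𝕜] E₀) (Q : F →L[𝕜] F₀),
    IsFiniteOp P → A.mem S → IsFiniteOp Q →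
    ‖finTrace (T.comp (P.comp (S.comp Q)))‖ ≤ c * ‖P‖ * A.nrm S * ‖Q‖

/-- The adjoint `𝒜*`. -/
def adjoint (A : OpClass 𝕜) : OpClass 𝕜 where
  mem T := ∃ c : ℝ, A.AdjointBound T c
  nrm T := sInf {c : ℝ | A.AdjointBound T c}

/-- `c` is an admissible constant in the definition of the conjugate `𝒜^Δ`. -/
def ConjugateBound (A : OpClass 𝕜) {E F : Type u}
    [NormedAddCommGroup E] [NormedSpace 𝕜 E] [CompleteSpace E]
    [NormedAddCommGroup F] [NormedSpace 𝕜 F] [CompleteSpace F]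
    (T : E →L[𝕜] F) (c : ℝ) : Prop :=
  0 ≤ c ∧ ∀ L : F →L[𝕜] E, IsFiniteOp L → ‖finTrace (T.comp L)‖ ≤ c * A.nrm L

/-- The conjugate `𝒜^Δ`. -/
def conjugate (A : OpClass 𝕜) : OpClass 𝕜 where
  mem T := ∃ c : ℝ, A.ConjugateBound T c
  nrm T := sInf {c : ℝ | A.ConjugateBound T c}

/-- Right-accessibility: every operator `T` from a finite-dimensional space `M` into a Banach
space `F` factors, with almost the same ideal norm, through the inclusion of a
finite-dimensional subspace `N` of `F`. -/
def IsRightAccessible (A : OpClass 𝕜) : Prop :=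
  ∀ (M F : Type u) [NormedAddCommGroup M] [NormedSpace 𝕜 M] [CompleteSpace M]
    [NormedAddCommGroup F] [NormedSpace 𝕜 F] [CompleteSpace F] [FiniteDimensional 𝕜 M]
    (T : M →L[𝕜] F) (ε : ℝ), 0 < ε →
    ∃ (N : Submodule 𝕜 F) (_ : FiniteDimensional 𝕜 N) (_ : CompleteSpace N)
      (S : M →L[𝕜] N), A.mem S ∧ T = N.subtypeL.comp S ∧ A.nrm S ≤ (1 + ε) * A.nrm T

/-- Left-accessibility: every operator `T` from a Banach space `E` into a finite-dimensional
space `N` factors, with almost the same ideal norm, through the quotient map of `E` onto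
`E ⧸ K` for a closed subspace `K` of finite codimension. -/
def IsLeftAccessible (A : OpClass 𝕜) : Prop :=
  ∀ (E N : Type u) [NormedAddCommGroup E] [NormedSpace 𝕜 E] [CompleteSpace E]
    [NormedAddCommGroup N] [NormedSpace 𝕜 N] [CompleteSpace N] [FiniteDimensional 𝕜 N]
    (T : E →L[𝕜] N) (ε : ℝ), 0 < ε →
    ∃ (K : Submodule 𝕜 E) (_ : IsClosed (K : Set E)) (_ : FiniteDimensional 𝕜 (E ⧸ K))
      (S : (E ⧸ K) →L[𝕜] N), A.mem S ∧ T = S.comp K.mkQL ∧ A.nrm S ≤ (1 + ε) * A.nrm T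

/-- Accessible: right- and left-accessible. -/
def IsAccessible (A : OpClass 𝕜) : Prop := A.IsRightAccessible ∧ A.IsLeftAccessible

/-- The `𝒜`-extension property. -/
def ExtensionProperty (A : OpClass 𝕜) : Prop :=
  ∀ (E F G : Type u) [NormedAddCommGroup E] [NormedSpace 𝕜 E] [CompleteSpace E]
    [NormedAddCommGroup F] [NormedSpace 𝕜 F] [CompleteSpace F]
    [NormedAddCommGroup G] [NormedSpace 𝕜 G] [CompleteSpace G]
    (ε : ℝ) (J : E →ₗᵢ[𝕜] G) (T : E →L[𝕜] F), 0 < ε → A.mem T →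
    ∃ T' : G →L[𝕜] F, A.mem T' ∧ T = T'.comp J.toContinuousLinearMap ∧
      A.nrm T' ≤ (1 + ε) * A.nrm T

end OpClass

end

section FiniteTrace

/-! ### Finite rank operators and their trace. -/

variable {𝕜 : Type u} [RCLike 𝕜] {E F G : Type u}
  [NormedAddCommGroup E] [NormedSpace 𝕜 E] [NormedAddCommGroup F] [NormedSpace 𝕜 F]
  [NormedAddCommGroup G] [NormedSpace 𝕜 G]

theorem IsFiniteOp.of_finiteDimensional_domain [FiniteDimensional 𝕜 E] (T : E →L[𝕜] F) :
    IsFiniteOp T :=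
  inferInstanceAs (FiniteDimensional 𝕜 (LinearMap.range (T : E →ₗ[𝕜] F)))

theorem IsFiniteOp.of_finiteDimensional_codomain [FiniteDimensional 𝕜 F] (T : E →L[𝕜] F) :
    IsFiniteOp T :=
  inferInstanceAs (FiniteDimensional 𝕜 (LinearMap.range (T : E →ₗ[𝕜] F)))

theorem IsFiniteOp.comp_left {T : E →L[𝕜] F} (hT : IsFiniteOp T) (S : F →L[𝕜] G) :
    IsFiniteOp (S.comp T) := by
  unfold IsFiniteOp at *
  have : LinearMap.range ((S.comp T : E →L[𝕜] G) : E →ₗ[𝕜] G) =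
      (LinearMap.range (T : E →ₗ[𝕜] F)).map (S : F →ₗ[𝕜] G) := LinearMap.range_comp _ _
  rw [this]
  infer_instance

theorem IsFiniteOp.comp_right {T : F →L[𝕜] G} (hT : IsFiniteOp T) (S : E →L[𝕜] F) :
    IsFiniteOp (T.comp S) := by
  unfold IsFiniteOp at *
  exact Submodule.finiteDimensional_of_le
    (LinearMap.range_comp_le_range (S : E →ₗ[𝕜] F) (T : F →ₗ[𝕜] G))

theorem IsFiniteOp.exists_range_factor {T : E →L[𝕜] F} (hT : IsFiniteOp T) :
    ∃ (N : Submodule 𝕜 F) (_ : FiniteDimensional 𝕜 N) (_ : CompleteSpace N)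
      (S : E →L[𝕜] N), T = N.subtypeL.comp S ∧ ‖S‖ ≤ ‖T‖ :=
  have : FiniteDimensional 𝕜 (LinearMap.range (T : E →ₗ[𝕜] F)) := hT
  ⟨_, hT, FiniteDimensional.complete 𝕜 _,
    T.codRestrict _ (fun x => LinearMap.mem_range_self (T : E →ₗ[𝕜] F) x), rfl,
    ContinuousLinearMap.opNorm_le_bound _ (norm_nonneg T) fun x => T.le_opNorm x⟩

/-- The trace can be computed from any factorization through a finite-dimensional space. -/
theorem finTrace_eq_trace {V : Type*} [AddCommGroup V] [Module 𝕜 V] [FiniteDimensional 𝕜 V]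
    (T : E →L[𝕜] E) (A : V →ₗ[𝕜] E) (B : E →ₗ[𝕜] V) (h : ∀ x, T x = A (B x)) :
    finTrace T = LinearMap.trace 𝕜 V (B ∘ₗ A) := by
  set R := LinearMap.range (T : E →ₗ[𝕜] E) with hR
  have hRA : R ≤ LinearMap.range A := by
    rintro _ ⟨x, rfl⟩
    exact ⟨B x, (h x).symm⟩
  have : FiniteDimensional 𝕜 R := Submodule.finiteDimensional_of_le hRA
  -- `C` is a linear section of `A` over the range of `T`; it moves the trace from that range to
  -- `V`.
  obtain ⟨C, hC⟩ := Module.projective_lifting_property A.rangeRestrict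
    (Submodule.inclusion hRA) A.surjective_rangeRestrict
  have hAC : A ∘ₗ C = R.subtype := by
    ext r
    have := congrArg Subtype.val (LinearMap.congr_fun hC r)
    simpa using this
  set B₁ : E →ₗ[𝕜] R := (T : E →ₗ[𝕜] E).rangeRestrict with hB₁
  have h1 : finTrace T = LinearMap.trace 𝕜 V (C ∘ₗ B₁ ∘ₗ A) := by
    unfold finTrace
    rw [← hAC]
    exact (LinearMap.trace_comp_comm' (B₁ ∘ₗ A) C).symm
  -- `C B₁ A` and `B A` may differ, but `A` kills their difference `(C B₁ - B) A`, so the difference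
  -- squares to zero and has trace zero.
  rw [h1, ← sub_eq_zero, ← map_sub]
  apply IsNilpotent.eq_zero
  apply LinearMap.isNilpotent_trace_of_isNilpotent
  refine ⟨2, ?_⟩
  ext v
  have key : ∀ x, A (C (B₁ x)) = A (B x) := fun x => by
    have := LinearMap.congr_fun hAC (B₁ x)
    simp only [LinearMap.comp_apply, Submodule.subtype_apply] at this
    rw [this, ← h]
    rfl
  simp [pow_two, key]

/-- The functionals `T ↦ tr(TL)` are finite sums of functionals `T ↦ a(T y)`. -/
theorem exists_finTrace_comp_eq_sum {L : F →L[𝕜] G} (hL : IsFiniteOp L) :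
    ∃ (n : ℕ) (a : Fin n → F →L[𝕜] 𝕜) (y : Fin n → G),
      ∀ T : G →L[𝕜] F, finTrace (T.comp L) = ∑ k, a k (T (y k)) := by
  have : FiniteDimensional 𝕜 (LinearMap.range (L : F →ₗ[𝕜] G)) := hL
  let b := Module.finBasis 𝕜 (LinearMap.range (L : F →ₗ[𝕜] G))
  refine ⟨_, fun k => (LinearMap.toContinuousLinearMap (b.coord k)).comp
    (L.codRestrict _ (fun x => LinearMap.mem_range_self (L : F →ₗ[𝕜] G) x)),
    fun k => b k, fun T => ?_⟩
  rw [finTrace_eq_trace (T.comp L)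
    ((T : G →ₗ[𝕜] F) ∘ₗ (LinearMap.range (L : F →ₗ[𝕜] G)).subtype)
    (L : F →ₗ[𝕜] G).rangeRestrict (fun _ => rfl), LinearMap.trace_eq_matrix_trace 𝕜 b]
  simp only [Matrix.trace, Matrix.diag, LinearMap.toMatrix_apply]
  rfl

end FiniteTrace

/-! ### Approximation in `ℓ^∞(I)` and embedding into it. -/

section BoundedFamilies

variable {𝕜 : Type u} [RCLike 𝕜] {I : Type u}

/-- Composition of bounded families of scalars with a map of the index set. -/
noncomputable def lpReindex (𝕜 : Type u) [RCLike 𝕜] {I : Type u} (r : I → I) :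
    lp (fun _ : I => 𝕜) ⊤ →L[𝕜] lp (fun _ : I => 𝕜) ⊤ :=
  LinearMap.mkContinuous
    { toFun := fun f => ⟨fun i => f (r i), memℓp_infty (by
        refine ⟨‖f‖, ?_⟩
        rintro _ ⟨i, rfl⟩
        exact lp.norm_apply_le_norm ENNReal.top_ne_zero f (r i))⟩
      map_add' := fun f g => by ext i; rfl
      map_smul' := fun c f => by ext i; rfl } 1
    (fun f => by
      rw [one_mul]
      exact lp.norm_le_of_forall_le (norm_nonneg f)
        (fun i => lp.norm_apply_le_norm ENNReal.top_ne_zero f (r i)))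

theorem norm_lpReindex_le (r : I → I) : ‖lpReindex 𝕜 r‖ ≤ 1 :=
  LinearMap.mkContinuous_norm_le _ zero_le_one _

/-- A family `f ∘ r` is constant on the fibres of `r`, so its values at one chosen point of each
fibre determine it. -/
theorem isFiniteOp_lpReindex {r : I → I} (hr : (Set.range r).Finite) :
    IsFiniteOp (lpReindex 𝕜 r) := by
  classical
  have := hr.fintype
  let D : LinearMap.range (lpReindex 𝕜 r : lp (fun _ : I => 𝕜) ⊤ →ₗ[𝕜]
      lp (fun _ : I => 𝕜) ⊤) →ₗ[𝕜] (Set.range r → 𝕜) :=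
    { toFun := fun f p => (f : lp (fun _ : I => 𝕜) ⊤) p.2.choose
      map_add' := fun f g => by ext i; rfl
      map_smul' := fun c f => by ext i; rfl }
  refine FiniteDimensional.of_injective D ?_
  rintro ⟨_, f, rfl⟩ ⟨_, g, rfl⟩ h
  ext i
  have h1 := congrFun h ⟨r i, i, rfl⟩
  have h2 : r (Exists.choose (⟨i, rfl⟩ : ∃ j, r j = r i)) = r i :=
    Exists.choose_spec (⟨i, rfl⟩ : ∃ j, r j = r i)
  change f (r _) = g (r _) at h1
  change f (r i) = g (r i)
  rwa [h2] at h1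

/-- The metric approximation property of `ℓ^∞(I)`. -/
theorem exists_lpReindex_close {n : ℕ} (y : Fin n → lp (fun _ : I => 𝕜) ⊤) {ε : ℝ}
    (hε : 0 < ε) :
    ∃ r : I → I, (Set.range r).Finite ∧ ∀ k, ‖y k - lpReindex 𝕜 r (y k)‖ ≤ ε := by
  classical
  -- The `y k` are treated jointly as one bounded map into `𝕜ⁿ`, whose range is totally bounded.
  let v : I → Fin n → 𝕜 := fun i k => y k i
  have hb : Bornology.IsBounded (Set.range v) := by
    refine (isBounded_iff_forall_norm_le).2 ⟨∑ k, ‖y k‖, ?_⟩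
    rintro _ ⟨i, rfl⟩
    refine (pi_norm_le_iff_of_nonneg (by positivity)).2 fun k => ?_
    exact (lp.norm_apply_le_norm ENNReal.top_ne_zero (y k) i).trans
      (Finset.single_le_sum (f := fun k => ‖y k‖) (fun _ _ => norm_nonneg _) (Finset.mem_univ k))
  have htb : TotallyBounded (Set.range v) :=
    (Metric.isCompact_of_isClosed_isBounded isClosed_closure hb.closure).totallyBounded.subset
      subset_closure
  -- The net is taken inside the range of `v`, so that each of its points is `v j` for an index `j`;
  -- `r` sends `i` to the index of a net point near `v i`.
  rw [totallyBounded_iff_subset] at htb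
  obtain ⟨t, ht, htf, hcov⟩ := htb _ (Metric.dist_mem_uniformity hε)
  have h1 : ∀ i, ∃ w ∈ t, dist (v i) w < ε := fun i => by
    simpa using hcov (Set.mem_range_self i)
  choose w hw hd using h1
  have h2 : ∀ x : t, ∃ j, v j = x := fun x => ht x.2
  choose s hs using h2
  refine ⟨fun i => s ⟨w i, hw i⟩, ?_, fun k => ?_⟩
  · have := htf.to_subtype
    exact (Set.finite_range s).subset (by rintro _ ⟨i, rfl⟩; exact ⟨_, rfl⟩)
  · refine lp.norm_le_of_forall_le hε.le fun i => ?_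
    have h3 := hd i
    rw [show w i = v (s ⟨w i, hw i⟩) from (hs ⟨w i, hw i⟩).symm] at h3
    have h4 := (dist_le_pi_dist (v i) (v (s ⟨w i, hw i⟩)) k).trans h3.le
    rwa [dist_eq_norm] at h4

variable (𝕜) in
/-- The isometric embedding of a normed space into the bounded families indexed by the dual
unit ball. -/
noncomputable def dualBallEmbedding (E : Type u) [NormedAddCommGroup E] [NormedSpace 𝕜 E] :
    E →ₗᵢ[𝕜] lp (fun _ : Metric.closedBall (0 : StrongDual 𝕜 E) 1 => 𝕜) ⊤ :=
  have hle : ∀ (x : E) (φ : Metric.closedBall (0 : StrongDual 𝕜 E) 1), ‖φ.1 x‖ ≤ ‖x‖ :=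
    fun x φ => by
      have := φ.1.le_of_opNorm_le (mem_closedBall_zero_iff.1 φ.2) x
      rwa [one_mul] at this
  { toFun := fun x => ⟨fun φ => φ.1 x, memℓp_infty (by
      refine ⟨‖x‖, ?_⟩
      rintro _ ⟨φ, rfl⟩
      exact hle x φ)⟩
    map_add' := fun x y => by ext φ; exact map_add φ.1 x y
    map_smul' := fun c x => by ext φ; exact map_smul φ.1 c x
    norm_map' := fun x => by
      refine le_antisymm (lp.norm_le_of_forall_le (norm_nonneg x) (hle x)) ?_
      obtain ⟨φ, hφ, hx⟩ := exists_dual_vector'' 𝕜 x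
      have := lp.norm_apply_le_norm ENNReal.top_ne_zero
        (⟨fun φ => φ.1 x, memℓp_infty (by
          refine ⟨‖x‖, ?_⟩
          rintro _ ⟨φ, rfl⟩
          exact hle x φ)⟩ : lp (fun _ : Metric.closedBall (0 : StrongDual 𝕜 E) 1 => 𝕜) ⊤)
        ⟨φ, by simpa using hφ⟩
      simpa [hx] using this }

end BoundedFamilies

/-! ### Elementary properties of the ideal norm. -/

namespace BanachIdeal

variable {𝕜 : Type u} [RCLike 𝕜] (A : BanachIdeal 𝕜)
  {D E F G : Type u}
  [NormedAddCommGroup D] [NormedSpace 𝕜 D] [CompleteSpace D]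
  [NormedAddCommGroup E] [NormedSpace 𝕜 E] [CompleteSpace E]
  [NormedAddCommGroup F] [NormedSpace 𝕜 F] [CompleteSpace F]
  [NormedAddCommGroup G] [NormedSpace 𝕜 G] [CompleteSpace G]

theorem mem_comp_left (S : F →L[𝕜] G) {T : E →L[𝕜] F} (hT : A.mem T) : A.mem (S.comp T) :=
  A.mem_comp S T (ContinuousLinearMap.id 𝕜 E) hT

theorem mem_zero : A.mem (0 : E →L[𝕜] F) := by
  apply A.mem_of_isFiniteOp
  unfold IsFiniteOp
  have : LinearMap.range ((0 : E →L[𝕜] F) : E →ₗ[𝕜] F) = ⊥ := LinearMap.range_zero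
  rw [this]
  infer_instance

theorem nrm_zero : A.nrm (0 : E →L[𝕜] F) = 0 := by
  simpa using A.nrm_smul (0 : 𝕜) (0 : E →L[𝕜] F) A.mem_zero

/-- Not an axiom: apply the triangle inequality to `T` and `-T`. -/
theorem nrm_nonneg {T : E →L[𝕜] F} (hT : A.mem T) : 0 ≤ A.nrm T := by
  have h := A.nrm_add_le T ((-1 : 𝕜) • T) hT (A.mem_smul _ _ hT)
  rw [A.nrm_smul _ _ hT, neg_one_smul, add_neg_cancel, A.nrm_zero, norm_neg, norm_one] at h
  linarith

theorem nrm_comp_le_of_le (S : F →L[𝕜] G) {T : E →L[𝕜] F} (R : D →L[𝕜] E) (hT : A.mem T)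
    {s r : ℝ} (hS : ‖S‖ ≤ s) (hR : ‖R‖ ≤ r) :
    A.nrm (S.comp (T.comp R)) ≤ s * A.nrm T * r := by
  have h0 := A.nrm_nonneg hT
  have hs : 0 ≤ s := (norm_nonneg S).trans hS
  exact (A.nrm_comp_le S T R hT).trans (by gcongr)

theorem nrm_comp_left_le (S : F →L[𝕜] G) {T : E →L[𝕜] F} (hT : A.mem T) :
    A.nrm (S.comp T) ≤ ‖S‖ * A.nrm T := by
  simpa using A.nrm_comp_le_of_le S (ContinuousLinearMap.id 𝕜 E) hT le_rfl
    ContinuousLinearMap.norm_id_le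

/-! ### Comparison of adjoint and conjugate bounds. -/

theorem adjointBound_of_conjugateBound {T : E →L[𝕜] F} {c : ℝ} (h : A.ConjugateBound T c) :
    A.AdjointBound T c := by
  refine ⟨h.1, fun E₀ F₀ _ _ _ _ _ _ P S Q hP hS _ => ?_⟩
  refine (h.2 _ (hP.comp_right _)).trans ?_
  calc c * A.nrm (P.comp (S.comp Q)) ≤ c * (‖P‖ * A.nrm S * ‖Q‖) :=
        mul_le_mul_of_nonneg_left (A.nrm_comp_le P S Q hS) h.1
    _ = c * ‖P‖ * A.nrm S * ‖Q‖ := by ring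

/-- The adjoint bound needs finite rank factors on both sides. The left one is the inclusion of the
range of `P`; left-accessibility supplies the right one, a quotient map of finite rank, at the cost
of a factor `1 + ε`. -/
theorem norm_finTrace_comp_comp_le (hleft : A.IsLeftAccessible) {T : E →L[𝕜] F} {c : ℝ}
    (hT : A.AdjointBound T c) {P : E →L[𝕜] E} (hP : IsFiniteOp P) (hP1 : ‖P‖ ≤ 1)
    {L : F →L[𝕜] E} (hL : A.mem L) :
    ‖finTrace (T.comp (P.comp L))‖ ≤ c * A.nrm L := by
  have hfin : FiniteDimensional 𝕜 (LinearMap.range (P : E →ₗ[𝕜] E)) := hP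
  have : CompleteSpace (LinearMap.range (P : E →ₗ[𝕜] E)) := FiniteDimensional.complete 𝕜 _
  let P₁ : E →L[𝕜] LinearMap.range (P : E →ₗ[𝕜] E) :=
    P.codRestrict _ (fun x => LinearMap.mem_range_self (P : E →ₗ[𝕜] E) x)
  let P₂ := (LinearMap.range (P : E →ₗ[𝕜] E)).subtypeL
  have hP₁ : ‖P₁‖ ≤ 1 := ContinuousLinearMap.opNorm_le_bound _ zero_le_one fun x =>
    P.le_of_opNorm_le hP1 x
  have hP₂ : ‖P₂‖ ≤ 1 := Submodule.norm_subtypeL_le _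
  have hL0 := A.nrm_nonneg hL
  have hPL : A.nrm (P₁.comp L) ≤ A.nrm L :=
    (A.nrm_comp_left_le P₁ hL).trans (mul_le_of_le_one_left hL0 hP₁)
  have hc := hT.1
  have main : ∀ ε : ℝ, 0 < ε → ‖finTrace (T.comp (P.comp L))‖ ≤ c * ((1 + ε) * A.nrm L) := by
    intro ε hε
    obtain ⟨K, hK, hKfin, S, hS, hfac, hnrm⟩ := hleft _ _ (P₁.comp L) ε hε
    have hS0 := A.nrm_nonneg hS
    have hQ : ‖K.mkQL‖ ≤ 1 := ContinuousLinearMap.opNorm_le_bound _ zero_le_one fun x => by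
      rw [one_mul]
      exact Submodule.Quotient.norm_mk_le K x
    have heq : P.comp L = P₂.comp (S.comp K.mkQL) := by
      rw [← hfac]
      rfl
    rw [heq]
    calc _ ≤ c * ‖P₂‖ * A.nrm S * ‖K.mkQL‖ :=
          hT.2 _ _ P₂ S K.mkQL (.of_finiteDimensional_domain _) hS
            (.of_finiteDimensional_codomain _)
      _ ≤ c * 1 * A.nrm S * 1 := by gcongr
      _ = c * A.nrm S := by ring
      _ ≤ c * ((1 + ε) * A.nrm L) := by
          gcongr
          exact hnrm.trans (by gcongr)
  refine ge_of_tendsto (x := nhdsWithin (0 : ℝ) (Set.Ioi 0))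
    (f := fun ε => c * ((1 + ε) * A.nrm L)) ?_ (eventually_mem_nhdsWithin.mono main)
  refine (Continuous.tendsto' (by fun_prop) _ _ (by simp)).mono_left nhdsWithin_le_nhds

/-- For fixed `L`, the trace of `TL` sees `T` at finitely many vectors only, and a finite rank
contraction almost fixes these; inserting it changes the trace arbitrarily little. -/
theorem norm_finTrace_comp_le_of_lp (hleft : A.IsLeftAccessible) {I : Type u}
    {T : lp (fun _ : I => 𝕜) ⊤ →L[𝕜] F} {c : ℝ} (hT : A.AdjointBound T c)
    {L : F →L[𝕜] lp (fun _ : I => 𝕜) ⊤} (hL : IsFiniteOp L) :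
    ‖finTrace (T.comp L)‖ ≤ c * A.nrm L := by
  obtain ⟨n, a, y, htr⟩ := exists_finTrace_comp_eq_sum hL
  have main : ∀ ε : ℝ, 0 < ε →
      ‖finTrace (T.comp L)‖ ≤ c * A.nrm L + ∑ k, ‖a k‖ * (‖T‖ * ε) := by
    intro ε hε
    obtain ⟨r, hr, hy⟩ := exists_lpReindex_close y hε
    have h1 := A.norm_finTrace_comp_comp_le hleft hT (isFiniteOp_lpReindex hr)
      (norm_lpReindex_le r) (A.mem_of_isFiniteOp L hL)
    have h2 : finTrace (T.comp L) - finTrace (T.comp ((lpReindex 𝕜 r).comp L)) =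
        ∑ k, a k (T (y k - lpReindex 𝕜 r (y k))) := by
      rw [← ContinuousLinearMap.comp_assoc, htr, htr, ← Finset.sum_sub_distrib]
      simp
    have h3 : ‖finTrace (T.comp L) - finTrace (T.comp ((lpReindex 𝕜 r).comp L))‖ ≤
        ∑ k, ‖a k‖ * (‖T‖ * ε) := by
      rw [h2]
      exact norm_sum_le_of_le _ fun k _ => (a k).le_opNorm_of_le (T.le_opNorm_of_le (hy k))
    linarith [norm_le_norm_add_norm_sub' (finTrace (T.comp L))
      (finTrace (T.comp ((lpReindex 𝕜 r).comp L)))]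
  refine ge_of_tendsto (x := nhdsWithin (0 : ℝ) (Set.Ioi 0))
    (f := fun ε => c * A.nrm L + ∑ k, ‖a k‖ * (‖T‖ * ε)) ?_ (eventually_mem_nhdsWithin.mono main)
  refine (Continuous.tendsto' (by fun_prop) _ _ (by simp)).mono_left nhdsWithin_le_nhds

/-- Since `T = T'J` with `T'` defined on `ℓ^∞`, the trace of `TL` is that of `T'(JL)`, and `J` does
not increase the ideal norm of `L`. -/
theorem conjugateBound_of_adjointBound (hleft : A.IsLeftAccessible)
    (hEP : A.adjoint.ExtensionProperty) {T : E →L[𝕜] F} {c : ℝ} (hT : A.AdjointBound T c) :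
    A.ConjugateBound T c := by
  refine ⟨hT.1, fun L hL => ?_⟩
  let J := dualBallEmbedding 𝕜 E
  have hLm := A.mem_of_isFiniteOp L hL
  have hL0 := A.nrm_nonneg hLm
  have hnrm : A.adjoint.nrm T ≤ c := csInf_le ⟨0, fun _ h => h.1⟩ hT
  have main : ∀ ε : ℝ, 0 < ε → ‖finTrace (T.comp L)‖ ≤ ((1 + ε) * c + ε) * A.nrm L := by
    intro ε hε
    obtain ⟨T', hT', hfac, hT'n⟩ := hEP _ _ _ ε J T hε ⟨c, hT⟩
    -- The additive `ε` makes the inequality strict even for `c = 0`, so an admissible constant for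
    -- `T'` lies below the target.
    obtain ⟨d, hd, hdlt⟩ := exists_lt_of_csInf_lt hT' (b := (1 + ε) * c + ε)
      (lt_of_le_of_lt (hT'n.trans (mul_le_mul_of_nonneg_left hnrm (by linarith)))
        (by linarith))
    have hd0 : 0 ≤ d := hd.1
    have h1 := A.norm_finTrace_comp_le_of_lp hleft hd (hL.comp_left J.toContinuousLinearMap)
    rw [hfac]
    refine h1.trans (mul_le_mul hdlt.le ?_ (A.nrm_nonneg (A.mem_comp_left _ hLm))
      (hd0.trans hdlt.le))
    exact (A.nrm_comp_left_le _ hLm).trans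
      (mul_le_of_le_one_left hL0 J.norm_toContinuousLinearMap_le)
  refine ge_of_tendsto (x := nhdsWithin (0 : ℝ) (Set.Ioi 0))
    (f := fun ε => ((1 + ε) * c + ε) * A.nrm L) ?_ (eventually_mem_nhdsWithin.mono main)
  refine (Continuous.tendsto' (by fun_prop) _ _ (by simp)).mono_left nhdsWithin_le_nhds

/-! ### Right-accessibility by separation and trace duality. -/

/-- Operators that factor through a finite-dimensional subspace of the codomain with a factor
of ideal norm less than one. -/
def subspaceBall (A : BanachIdeal 𝕜) (M F : Type u)
    [NormedAddCommGroup M] [NormedSpace 𝕜 M] [CompleteSpace M]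
    [NormedAddCommGroup F] [NormedSpace 𝕜 F] [CompleteSpace F] : Set (M →L[𝕜] F) :=
  {T | ∃ (N : Submodule 𝕜 F) (_ : FiniteDimensional 𝕜 N) (_ : CompleteSpace N)
    (S : M →L[𝕜] N), A.mem S ∧ T = N.subtypeL.comp S ∧ A.nrm S < 1}

theorem smul_mem_subspaceBall {T : E →L[𝕜] F} (hT : T ∈ A.subspaceBall E F) {z : 𝕜}
    (hz : ‖z‖ ≤ 1) : z • T ∈ A.subspaceBall E F := by
  obtain ⟨N, hN, hNc, S, hS, rfl, hlt⟩ := hT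
  refine ⟨N, hN, hNc, z • S, A.mem_smul _ _ hS, by ext; simp, ?_⟩
  rw [A.nrm_smul _ _ hS]
  exact (mul_le_of_le_one_left (A.nrm_nonneg hS) hz).trans_lt hlt

/-- The inclusions of `N₁` and `N₂` into `N₁ ⊔ N₂` are contractions. This gives both convexity and
openness of `subspaceBall`. -/
theorem exists_sup_factor {E F : Type u}
    [NormedAddCommGroup E] [NormedSpace 𝕜 E] [CompleteSpace E]
    [NormedAddCommGroup F] [NormedSpace 𝕜 F] {N₁ N₂ : Submodule 𝕜 F} [FiniteDimensional 𝕜 N₁]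
    [FiniteDimensional 𝕜 N₂] [CompleteSpace N₁] [CompleteSpace N₂]
    {S₁ : E →L[𝕜] N₁} {S₂ : E →L[𝕜] N₂} (h₁ : A.mem S₁) (h₂ : A.mem S₂) :
    ∃ (N : Submodule 𝕜 F) (_ : FiniteDimensional 𝕜 N) (_ : CompleteSpace N)
      (S : E →L[𝕜] N), A.mem S ∧
      N₁.subtypeL.comp S₁ + N₂.subtypeL.comp S₂ = N.subtypeL.comp S ∧
      A.nrm S ≤ A.nrm S₁ + A.nrm S₂ := by
  have hc : CompleteSpace (N₁ ⊔ N₂ : Submodule 𝕜 F) := FiniteDimensional.complete 𝕜 _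
  let i₁ : N₁ →L[𝕜] (N₁ ⊔ N₂ : Submodule 𝕜 F) :=
    N₁.subtypeL.codRestrict _ (fun x => Submodule.mem_sup_left x.2)
  let i₂ : N₂ →L[𝕜] (N₁ ⊔ N₂ : Submodule 𝕜 F) :=
    N₂.subtypeL.codRestrict _ (fun x => Submodule.mem_sup_right x.2)
  have hi₁ : ‖i₁‖ ≤ 1 := ContinuousLinearMap.opNorm_le_bound _ zero_le_one fun x =>
    (one_mul ‖x‖).ge
  have hi₂ : ‖i₂‖ ≤ 1 := ContinuousLinearMap.opNorm_le_bound _ zero_le_one fun x =>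
    (one_mul ‖x‖).ge
  refine ⟨N₁ ⊔ N₂, inferInstance, hc, i₁.comp S₁ + i₂.comp S₂,
    A.mem_add _ _ (A.mem_comp_left _ h₁) (A.mem_comp_left _ h₂), by ext; rfl, ?_⟩
  refine (A.nrm_add_le _ _ (A.mem_comp_left _ h₁) (A.mem_comp_left _ h₂)).trans (add_le_add ?_ ?_)
  · exact (A.nrm_comp_left_le _ h₁).trans (mul_le_of_le_one_left (A.nrm_nonneg h₁) hi₁)
  · exact (A.nrm_comp_left_le _ h₂).trans (mul_le_of_le_one_left (A.nrm_nonneg h₂) hi₂)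

theorem convex_subspaceBall [NormedSpace ℝ F] [IsScalarTower ℝ 𝕜 F] :
    Convex ℝ (A.subspaceBall E F) := by
  rintro _ ⟨N₁, _, _, S₁, h₁, rfl, hlt₁⟩ _ ⟨N₂, _, _, S₂, h₂, rfl, hlt₂⟩ a b ha hb hab
  obtain ⟨N, hN, hNc, S, hS, heq, hle⟩ :=
    A.exists_sup_factor (A.mem_smul (a : 𝕜) _ h₁) (A.mem_smul (b : 𝕜) _ h₂)
  refine ⟨N, hN, hNc, S, hS, ?_, ?_⟩
  · rw [← heq]
    ext x
    exact congrArg₂ (· + ·) (RCLike.real_smul_eq_coe_smul (K := 𝕜) a (S₁ x : F))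
      (RCLike.real_smul_eq_coe_smul (K := 𝕜) b (S₂ x : F))
  · refine hle.trans_lt ?_
    rw [A.nrm_smul _ _ h₁, A.nrm_smul _ _ h₂, RCLike.norm_ofReal, RCLike.norm_ofReal,
      abs_of_nonneg ha, abs_of_nonneg hb]
    rcases ha.eq_or_lt with rfl | ha
    · have : b = 1 := by linarith
      subst this
      linarith
    · nlinarith [mul_lt_mul_of_pos_left hlt₁ ha, mul_le_mul_of_nonneg_left hlt₂.le hb]

/-- A perturbation `D` factors through its own range with ideal norm at most `‖D‖ 𝐀(id_E)`, which is
finite because `E` is finite-dimensional. -/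
theorem isOpen_subspaceBall [FiniteDimensional 𝕜 E] : IsOpen (A.subspaceBall E F) := by
  rw [Metric.isOpen_iff]
  rintro T ⟨N₁, _, _, S₁, h₁, rfl, hlt⟩
  have hid : A.mem (ContinuousLinearMap.id 𝕜 E) :=
    A.mem_of_isFiniteOp _ (.of_finiteDimensional_domain _)
  have hC := A.nrm_nonneg hid
  set C := A.nrm (ContinuousLinearMap.id 𝕜 E)
  -- `C + 1` instead of `C`, as `C = 0` when `E` is trivial.
  refine ⟨(1 - A.nrm S₁) / (C + 1), div_pos (by linarith) (by linarith), fun T' hT' => ?_⟩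
  rw [Metric.mem_ball, dist_eq_norm, lt_div_iff₀ (by linarith)] at hT'
  obtain ⟨N₂, _, _, S₂, hfac, hn⟩ := IsFiniteOp.exists_range_factor
    (.of_finiteDimensional_domain (T' - N₁.subtypeL.comp S₁))
  have h₂ : A.mem S₂ := A.mem_of_isFiniteOp _ (.of_finiteDimensional_domain _)
  obtain ⟨N, hN, hNc, S, hS, heq, hle⟩ := A.exists_sup_factor h₁ h₂
  refine ⟨N, hN, hNc, S, hS, ?_, hle.trans_lt ?_⟩
  · rw [← heq, ← hfac]
    abel
  · have := A.nrm_comp_left_le S₂ hid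
    rw [ContinuousLinearMap.comp_id] at this
    have h3 : ‖S₂‖ * C ≤ ‖T' - N₁.subtypeL.comp S₁‖ * C := by gcongr
    nlinarith [norm_nonneg (T' - N₁.subtypeL.comp S₁)]

/-- Trace duality: every functional on `L(M, F)`, with `M` finite-dimensional, is
`T ↦ tr(UT)` for some `U`. -/
theorem exists_finTrace_eq {M F : Type u} [NormedAddCommGroup M] [NormedSpace 𝕜 M]
    [NormedAddCommGroup F] [NormedSpace 𝕜 F]
    [FiniteDimensional 𝕜 M] (f : StrongDual 𝕜 (M →L[𝕜] F)) :
    ∃ U : F →L[𝕜] M, ∀ T : M →L[𝕜] F, finTrace (U.comp T) = f T := by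
  let b := Module.finBasis 𝕜 M
  let β : ∀ k, M →L[𝕜] 𝕜 := fun k => LinearMap.toContinuousLinearMap (b.coord k)
  -- `U y = ∑ f(β_k ⊗ y) b_k`, read off from the expansion `T = ∑ β_k ⊗ T b_k`.
  let U : F →L[𝕜] M := ∑ k, ((f.comp
    (ContinuousLinearMap.smulRightL 𝕜 M F (β k))).smulRight (b k))
  refine ⟨U, fun T => ?_⟩
  rw [finTrace_eq_trace (U.comp T) LinearMap.id ((U.comp T : M →L[𝕜] M) : M →ₗ[𝕜] M)
    (fun _ => rfl), LinearMap.comp_id, LinearMap.trace_eq_matrix_trace 𝕜 b]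
  simp only [Matrix.trace, Matrix.diag, LinearMap.toMatrix_apply]
  have hT : T = ∑ k, (β k).smulRight (T (b k)) := by
    ext x
    have hx := congrArg T (b.sum_repr x)
    rw [map_sum] at hx
    simpa [β] using hx.symm
  conv_rhs => rw [hT, map_sum]
  refine Finset.sum_congr rfl fun k _ => ?_
  simp [U, Finsupp.single_apply]

/-- A functional bounded by `c` on `subspaceBall` is a trace `tr(U ·)` with adjoint constant `c` for
`U`. By `h` this is a conjugate constant, so the functional cannot reach `c` at an operator of ideal
norm below one. -/
theorem isRightAccessible (h : ∀ {E F : Type u} [NormedAddCommGroup E] [NormedSpace 𝕜 E]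
    [CompleteSpace E] [NormedAddCommGroup F] [NormedSpace 𝕜 F] [CompleteSpace F]
    {T : E →L[𝕜] F} {c : ℝ}, A.AdjointBound T c → A.ConjugateBound T c) :
    A.IsRightAccessible := by
  intro M F _ _ _ _ _ _ _ T ε hε
  have hTfin : IsFiniteOp T := .of_finiteDimensional_domain T
  have hTm := A.mem_of_isFiniteOp T hTfin
  rcases (A.nrm_nonneg hTm).eq_or_lt with h0 | h0
  · have hT0 := A.eq_zero_of_nrm_eq_zero T hTm h0.symm
    refine ⟨⊥, inferInstance, inferInstance, 0, A.mem_zero, by rw [hT0]; ext; simp, ?_⟩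
    rw [A.nrm_zero, ← h0, mul_zero]
  have ht0 : 0 < (1 + ε) * A.nrm T := by positivity
  have htn : ‖(((1 + ε) * A.nrm T : ℝ) : 𝕜)‖ = (1 + ε) * A.nrm T := by
    rw [RCLike.norm_ofReal, abs_of_pos ht0]
  have hne : (((1 + ε) * A.nrm T : ℝ) : 𝕜) ≠ 0 := RCLike.ofReal_ne_zero.2 ht0.ne'
  suffices hmem : (((1 + ε) * A.nrm T : ℝ) : 𝕜)⁻¹ • T ∈ A.subspaceBall M F by
    obtain ⟨N, hN, hNc, S, hS, heq, hlt⟩ := hmem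
    refine ⟨N, hN, hNc, (((1 + ε) * A.nrm T : ℝ) : 𝕜) • S, A.mem_smul _ _ hS, ?_, ?_⟩
    · rw [ContinuousLinearMap.comp_smul, ← heq, smul_smul, mul_inv_cancel₀ hne, one_smul]
    · rw [A.nrm_smul _ _ hS, htn]
      exact mul_le_of_le_one_right ht0.le hlt.le
  by_contra hnot
  set T₁ := (((1 + ε) * A.nrm T : ℝ) : 𝕜)⁻¹ • T with hT₁
  have hT₁n : A.nrm T₁ < 1 := by
    rw [hT₁, A.nrm_smul _ _ hTm, norm_inv, htn, mul_inv, mul_assoc, inv_mul_cancel₀ h0.ne',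
      mul_one]
    exact inv_lt_one_of_one_lt₀ (by linarith)
  let : NormedSpace ℝ F := NormedSpace.restrictScalars ℝ 𝕜 F
  have : IsScalarTower ℝ 𝕜 F := RestrictScalars.isScalarTower ℝ 𝕜 F
  obtain ⟨f, hf⟩ := RCLike.geometric_hahn_banach_open_point (𝕜 := 𝕜) A.convex_subspaceBall
    A.isOpen_subspaceBall hnot
  have hc0 : 0 < RCLike.re (f T₁) := by
    have : (0 : M →L[𝕜] F) ∈ A.subspaceBall M F :=
      ⟨⊥, inferInstance, inferInstance, 0, A.mem_zero, by ext; simp, by simp [A.nrm_zero]⟩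
    simpa using hf 0 this
  have hbd : ∀ R ∈ A.subspaceBall M F, ‖f R‖ ≤ RCLike.re (f T₁) := by
    intro R hR
    -- The ball is stable under unimodular scalars, so the bound on real parts is a bound on
    -- absolute values.
    obtain ⟨z, hz, hzf⟩ := RCLike.exists_norm_eq_mul_self (f R)
    have h1 := hf _ (A.smul_mem_subspaceBall hR hz.le)
    rw [map_smul, smul_eq_mul, ← hzf, RCLike.ofReal_re] at h1
    exact h1.le
  obtain ⟨U, hU⟩ := exists_finTrace_eq f
  have hadj : A.AdjointBound U (RCLike.re (f T₁)) := by
    refine ⟨hc0.le, fun E₀ F₀ _ _ _ _ _ _ P S Q hP hS _ => ?_⟩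
    rw [hU]
    have hS0 := A.nrm_nonneg hS
    have main : ∀ t : ℝ, ‖P‖ * A.nrm S * ‖Q‖ < t →
        ‖f (P.comp (S.comp Q))‖ ≤ RCLike.re (f T₁) * t := by
      intro t ht
      have htpos : 0 < t := lt_of_le_of_lt (by positivity) ht
      -- The range of `P` serves as the finite-dimensional subspace that puts `PSQ / t` in the ball.
      obtain ⟨N, hN, hNc, P₀, hfac, hn⟩ := hP.exists_range_factor
      have hm := A.mem_comp P₀ S Q hS
      have hin : ((t : 𝕜)⁻¹) • P.comp (S.comp Q) ∈ A.subspaceBall M F := by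
        refine ⟨N, hN, hNc, ((t : 𝕜)⁻¹) • P₀.comp (S.comp Q), A.mem_smul _ _ hm, ?_, ?_⟩
        · rw [ContinuousLinearMap.comp_smul, hfac, ContinuousLinearMap.comp_assoc]
        · rw [A.nrm_smul _ _ hm, norm_inv, RCLike.norm_ofReal, abs_of_pos htpos,
            inv_mul_lt_iff₀ htpos, mul_one]
          exact (A.nrm_comp_le_of_le P₀ Q hS hn le_rfl).trans_lt ht
      have h2 := hbd _ hin
      rwa [map_smul, norm_smul, norm_inv, RCLike.norm_ofReal, abs_of_pos htpos,
        inv_mul_le_iff₀ htpos, mul_comm] at h2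
    have hmul : RCLike.re (f T₁) * ‖P‖ * A.nrm S * ‖Q‖ =
        RCLike.re (f T₁) * (‖P‖ * A.nrm S * ‖Q‖) := by ring
    rw [hmul, ← div_le_iff₀' hc0]
    exact le_of_forall_gt_imp_ge_of_dense fun t ht => (div_le_iff₀' hc0).2 (main t ht)
  have hconj := (h hadj).2 T₁ (.of_finiteDimensional_domain T₁)
  rw [hU] at hconj
  have h3 := (RCLike.re_le_norm (f T₁)).trans hconj
  have h4 := mul_lt_mul_of_pos_left hT₁n hc0
  linarith

end BanachIdeal

/-! ### The theorem. -/

theorem theorem4p7 {𝕜 : Type u} [RCLike 𝕜] (A : BanachIdeal 𝕜)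
    (hmax : A.IsMaximal) (hleft : A.IsLeftAccessible)
    (hEP : A.adjoint.ExtensionProperty) :
    A.IsAccessible ∧ A.conjugate.conjugate.IsometricEq A.adjoint.conjugate := by
  have hbound : ∀ {E F : Type u} [NormedAddCommGroup E] [NormedSpace 𝕜 E]
      [CompleteSpace E] [NormedAddCommGroup F] [NormedSpace 𝕜 F] [CompleteSpace F]
      (T : E →L[𝕜] F), A.AdjointBound T = A.ConjugateBound T := fun T => by
    funext c
    exact propext ⟨A.conjugateBound_of_adjointBound hleft hEP, A.adjointBound_of_conjugateBound⟩
  refine ⟨⟨A.isRightAccessible fun h => A.conjugateBound_of_adjointBound hleft hEP h, hleft⟩,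
    fun E F _ _ _ _ _ _ T => ?_⟩
  -- Both norms are infima of the same set of constants, and a conjugate bound depends on the class
  -- only through its norm.
  have hT : A.conjugate.ConjugateBound T = A.adjoint.ConjugateBound T := by
    funext c
    simp only [OpClass.ConjugateBound, OpClass.conjugate, OpClass.adjoint, hbound]
  simp only [OpClass.conjugate] at hT ⊢
  exact ⟨by rw [hT], fun _ => by rw [hT]⟩
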